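/- Let $B$ be the Beurling–Ahlfors operator on $L^2(\mathbb{C})$, that is, the Fourier multiplier with symbol $\xi\mapsto\overline{\xi}/\xi$, let $\mathrm{Re}\,B$ and $\mathrm{Im}\,B$ be the Fourier multipliers on $L^2(\mathbb{C})$ with the real-valued symbols $\mathrm{Re}(\overline{\xi}/\xi)$ and $\mathrm{Im}(\overline{\xi}/\xi)$, let $\mathbb{D}=\{z\in\mathbb{C}:|z|<1\}$, and write $|A|$ for the Lebesgue measure and $\chi_A$ for the indicator function of a measurable set $A\subset\mathbb{C}$. For every real number $\eta<1$ there are measurable sets $E\subset D\subset\mathbb{D}$ with $|E|>0$ such that $$\int_{D\setminus E}\bigl|(\mathrm{Re}\,B)\chi_E(z)\bigr|\,dz\;\ge\;\eta\,|E|\ln\!\left(\frac{e|D|}{2|E|}\right).$$ Likewise, for every real number $\eta<1$ there are measurable sets $E\subset D\subset\mathbb{D}$ with $|E|>0$ such that the same inequality holds with $\mathrm{Re}\,B$ replaced by $\mathrm{Im}\,B$. -/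

import Mathlib

open MeasureTheory
open scoped FourierTransform ENNReal ComplexConjugate

noncomputable section

/-- The Fourier multiplier operator `T_m` on `L²(ℂ)` with a bounded measurable symbol `m`:
`T_m f = 𝓕⁻¹ (m · 𝓕 f)`, with `𝓕` the `L²` Fourier transform on `ℂ = ℝ²`. -/
def fourierMultiplier (m : ℂ → ℂ) (hm : MemLp m ∞ (volume : Measure ℂ))
    (f : Lp ℂ 2 (volume : Measure ℂ)) : Lp ℂ 2 (volume : Measure ℂ) :=
  𝓕⁻ ((hm.toLp m • 𝓕 f : Lp ℂ 2 (volume : Measure ℂ)))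

/-- The symbol `ξ ↦ conj ξ / ξ` of the Beurling–Ahlfors operator (with value `0` at `ξ = 0`). -/
def beurlingSymbol (ξ : ℂ) : ℂ := conj ξ / ξ

theorem measurable_beurlingSymbol : Measurable beurlingSymbol :=
  Complex.continuous_conj.measurable.div measurable_id

theorem norm_beurlingSymbol_le (ξ : ℂ) : ‖beurlingSymbol ξ‖ ≤ 1 := by
  simpa [beurlingSymbol] using div_self_le_one ‖ξ‖

theorem memLp_beurlingSymbol : MemLp beurlingSymbol ∞ (volume : Measure ℂ) :=
  memLp_top_of_bound measurable_beurlingSymbol.aestronglyMeasurable 1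
    (Filter.Eventually.of_forall norm_beurlingSymbol_le)

theorem memLp_re_beurlingSymbol :
    MemLp (fun ξ : ℂ => ((beurlingSymbol ξ).re : ℂ)) ∞ (volume : Measure ℂ) :=
  memLp_top_of_bound
    (Complex.measurable_ofReal.comp
      (Complex.measurable_re.comp measurable_beurlingSymbol)).aestronglyMeasurable 1
    (Filter.Eventually.of_forall fun ξ => by
      simpa using (Complex.abs_re_le_norm _).trans (norm_beurlingSymbol_le ξ))

theorem memLp_im_beurlingSymbol :
    MemLp (fun ξ : ℂ => ((beurlingSymbol ξ).im : ℂ)) ∞ (volume : Measure ℂ) :=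
  memLp_top_of_bound
    (Complex.measurable_ofReal.comp
      (Complex.measurable_im.comp measurable_beurlingSymbol)).aestronglyMeasurable 1
    (Filter.Eventually.of_forall fun ξ => by
      simpa using (Complex.abs_im_le_norm _).trans (norm_beurlingSymbol_le ξ))

/-- The Beurling–Ahlfors operator `B`. -/
def beurling : Lp ℂ 2 (volume : Measure ℂ) → Lp ℂ 2 (volume : Measure ℂ) :=
  fourierMultiplier beurlingSymbol memLp_beurlingSymbol

/-- The real part `Re B` of the Beurling–Ahlfors operator: the multiplier with symbol
`Re (conj ξ / ξ) = (ξ₁² - ξ₂²) / |ξ|²`, that is `R₂² - R₁²` with `R₁, R₂` the Riesz transforms. -/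
def reBeurling : Lp ℂ 2 (volume : Measure ℂ) → Lp ℂ 2 (volume : Measure ℂ) :=
  fourierMultiplier (fun ξ => ((beurlingSymbol ξ).re : ℂ)) memLp_re_beurlingSymbol

/-- The imaginary part `Im B` of the Beurling–Ahlfors operator: the multiplier with symbol
`Im (conj ξ / ξ) = -2 ξ₁ ξ₂ / |ξ|²`, that is, up to sign, twice the product `R₁ R₂` of the
Riesz transforms. -/
def imBeurling : Lp ℂ 2 (volume : Measure ℂ) → Lp ℂ 2 (volume : Measure ℂ) :=
  fourierMultiplier (fun ξ => ((beurlingSymbol ξ).im : ℂ)) memLp_im_beurlingSymbol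

/-- `B = Re B + i Im B`. -/
theorem beurling_eq (f : Lp ℂ 2 (volume : Measure ℂ)) :
    beurling f = reBeurling f + Complex.I • imBeurling f := by
  unfold beurling reBeurling imBeurling fourierMultiplier
  rw [← FourierTransform.fourierInv_smul, ← FourierTransform.fourierInv_add]
  congr 1
  apply Lp.ext
  filter_upwards [Lp.coeFn_lpSMul (r := 2) (memLp_beurlingSymbol.toLp beurlingSymbol) (𝓕 f),
    Lp.coeFn_lpSMul (r := 2) (memLp_re_beurlingSymbol.toLp _) (𝓕 f),
    Lp.coeFn_lpSMul (r := 2) (memLp_im_beurlingSymbol.toLp _) (𝓕 f),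
    memLp_beurlingSymbol.coeFn_toLp, memLp_re_beurlingSymbol.coeFn_toLp,
    memLp_im_beurlingSymbol.coeFn_toLp,
    Lp.coeFn_add ((memLp_re_beurlingSymbol.toLp _ • 𝓕 f : Lp ℂ 2 (volume : Measure ℂ)))
      (Complex.I • (memLp_im_beurlingSymbol.toLp _ • 𝓕 f : Lp ℂ 2 (volume : Measure ℂ))),
    Lp.coeFn_smul Complex.I
      (memLp_im_beurlingSymbol.toLp _ • 𝓕 f : Lp ℂ 2 (volume : Measure ℂ))]
    with ξ h1 h2 h3 h4 h5 h6 h7 h8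
  rw [h7, Pi.add_apply, h8, Pi.smul_apply, h1, h2, h3]
  simp only [Pi.smul_apply', h4, h5, h6, smul_eq_mul]
  conv_lhs => rw [← Complex.re_add_im (beurlingSymbol ξ)]
  ring

end

section

open Filter Topology

/-! The extremal set is an iterated laminate. Start from the disc `E 0` and cut `E k` by very fine
parallel stripes keeping a proportion θ. The stripe normal alternates between a direction where the
symbol tends to 1 and one where it tends to -1. The function `1_{E (k+1)} - θ 1_{E k}` oscillates at
frequencies running to infinity along the normal, so the multiplier `T` acts on it almost as
`(-1)^k` (`tendsto_apply_stripes`, `exists_subset_norm_multiplier_le`). Telescoping gives `T 1_{E n}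
≈ θ^n T 1_{E 0} + lamValue`, where the last term is an explicit step function.

Because the signs alternate, this step function has modulus at least `θ^(n-j+1)` on the layer `E j \
E (j+1)` (`lamBound_le_abs_lamValue`). That layer has area about `θ^j (1-θ) π`, so each of the `n`
layers contributes about `θ (1-θ) |E n|`. The term `θ^n T 1_{E 0}` costs at most `θ^n π ≈ |E n|` by
Cauchy–Schwarz (`IsLamination.le_setIntegral`). With `D` the disc, the logarithm is about `n (-log
θ) + 1 - log 2`. For large `n` only the ratio `θ (1-θ) / (-log θ)` matters, and it tends to 1 as θ →
1 (`exists_ratio`). -/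

/-! ### Bounded Fourier multipliers on L². -/

/-- Multiplication by a bounded function, as a continuous linear map on `L²(ℂ)`. -/
noncomputable def mulBounded (m : ℂ → ℂ) (hm : MemLp m ∞ (volume : Measure ℂ)) :
    Lp ℂ 2 (volume : Measure ℂ) →L[ℂ] Lp ℂ 2 (volume : Measure ℂ) :=
  (ContinuousLinearMap.mul ℂ ℂ).holderL volume ∞ 2 2 (hm.toLp m)

theorem coeFn_mulBounded (m : ℂ → ℂ) (hm : MemLp m ∞ (volume : Measure ℂ))
    (f : Lp ℂ 2 (volume : Measure ℂ)) :
    mulBounded m hm f =ᵐ[volume] fun z => m z * f z := by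
  have h := (ContinuousLinearMap.mul ℂ ℂ).coeFn_holder (r := 2) (hm.toLp m) f
  filter_upwards [h, hm.coeFn_toLp] with z h1 h2
  rw [mulBounded, ContinuousLinearMap.holderL_apply_apply, h1, h2]
  rfl

theorem mulBounded_eq_smul (m : ℂ → ℂ) (hm : MemLp m ∞ (volume : Measure ℂ))
    (f : Lp ℂ 2 (volume : Measure ℂ)) :
    mulBounded m hm f = (hm.toLp m • f : Lp ℂ 2 (volume : Measure ℂ)) := by
  apply Lp.ext
  filter_upwards [coeFn_mulBounded m hm f, Lp.coeFn_lpSMul (r := 2) (hm.toLp m) f,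
    hm.coeFn_toLp] with z h1 h2 h3
  rw [h1, h2, Pi.smul_apply', h3, smul_eq_mul]

theorem norm_mulBounded_le {m : ℂ → ℂ} (hm : MemLp m ∞ (volume : Measure ℂ)) {C : ℝ}
    (hC : ∀ z, ‖m z‖ ≤ C) (f : Lp ℂ 2 (volume : Measure ℂ)) :
    ‖mulBounded m hm f‖ ≤ C * ‖f‖ := by
  apply Lp.norm_le_mul_norm_of_ae_le_mul
  filter_upwards [coeFn_mulBounded m hm f] with z h
  rw [h, norm_mul]
  gcongr
  exact hC z

/-- The Fourier multiplier with a bounded symbol, as a continuous linear map on `L²(ℂ)`. -/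
noncomputable def multiplierCLM (m : ℂ → ℂ) (hm : MemLp m ∞ (volume : Measure ℂ)) :
    Lp ℂ 2 (volume : Measure ℂ) →L[ℂ] Lp ℂ 2 (volume : Measure ℂ) :=
  ((Lp.fourierTransformₗᵢ ℂ ℂ).symm.toContinuousLinearEquiv :
      Lp ℂ 2 (volume : Measure ℂ) →L[ℂ] Lp ℂ 2 (volume : Measure ℂ)) ∘L mulBounded m hm ∘L
    ((Lp.fourierTransformₗᵢ ℂ ℂ).toContinuousLinearEquiv :
      Lp ℂ 2 (volume : Measure ℂ) →L[ℂ] Lp ℂ 2 (volume : Measure ℂ))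

theorem multiplierCLM_apply (m : ℂ → ℂ) (hm : MemLp m ∞ (volume : Measure ℂ))
    (f : Lp ℂ 2 (volume : Measure ℂ)) : multiplierCLM m hm f = 𝓕⁻ (mulBounded m hm (𝓕 f)) :=
  rfl

theorem multiplierCLM_eq_fourierMultiplier (m : ℂ → ℂ) (hm : MemLp m ∞ (volume : Measure ℂ))
    (f : Lp ℂ 2 (volume : Measure ℂ)) : multiplierCLM m hm f = fourierMultiplier m hm f := by
  rw [multiplierCLM_apply, mulBounded_eq_smul, fourierMultiplier]

theorem norm_multiplierCLM (m : ℂ → ℂ) (hm : MemLp m ∞ (volume : Measure ℂ))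
    (f : Lp ℂ 2 (volume : Measure ℂ)) : ‖multiplierCLM m hm f‖ = ‖mulBounded m hm (𝓕 f)‖ := by
  rw [multiplierCLM_apply]
  exact (Lp.fourierTransformₗᵢ ℂ ℂ).symm.norm_map _

theorem norm_multiplierCLM_le {m : ℂ → ℂ} (hm : MemLp m ∞ (volume : Measure ℂ)) {C : ℝ}
    (hC : ∀ z, ‖m z‖ ≤ C) (f : Lp ℂ 2 (volume : Measure ℂ)) :
    ‖multiplierCLM m hm f‖ ≤ C * ‖f‖ := by
  rw [norm_multiplierCLM]
  exact (norm_mulBounded_le hm hC _).trans_eq (by rw [Lp.norm_fourier_eq])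

theorem multiplierCLM_sub_const {m : ℂ → ℂ} (hm : MemLp m ∞ (volume : Measure ℂ)) (s : ℂ)
    (hms : MemLp (fun ξ => m ξ - s) ∞ (volume : Measure ℂ)) (f : Lp ℂ 2 (volume : Measure ℂ)) :
    multiplierCLM (fun ξ => m ξ - s) hms f = multiplierCLM m hm f - s • f := by
  have h : mulBounded (fun ξ => m ξ - s) hms (𝓕 f) = mulBounded m hm (𝓕 f) - s • 𝓕 f := by
    apply Lp.ext
    filter_upwards [coeFn_mulBounded _ hms (𝓕 f), coeFn_mulBounded m hm (𝓕 f),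
      Lp.coeFn_sub (mulBounded m hm (𝓕 f)) (s • 𝓕 f), Lp.coeFn_smul s (𝓕 f)] with z h1 h2 h3 h4
    rw [h1, h3, Pi.sub_apply, h2, h4, Pi.smul_apply, smul_eq_mul]
    ring
  rw [multiplierCLM_apply, multiplierCLM_apply, h, sub_eq_add_neg,
    FourierTransform.fourierInv_add, FourierTransform.fourierInv_neg,
    FourierTransform.fourierInv_smul,
    FourierTransform.fourierInv_fourier_eq, sub_eq_add_neg]

/-! ### Modulation and high-frequency limits. -/

/-- The character `z ↦ e^{2πi⟪z, v⟫}` of `ℂ`. -/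
noncomputable def planeWave (v z : ℂ) : ℂ := (Real.fourierChar (inner ℝ z v) : ℂ)

theorem continuous_planeWave (v : ℂ) : Continuous (planeWave v) := by
  unfold planeWave
  fun_prop

theorem norm_planeWave (v z : ℂ) : ‖planeWave v z‖ = 1 := Circle.norm_coe _

theorem memLp_planeWave (v : ℂ) : MemLp (planeWave v) ∞ (volume : Measure ℂ) :=
  memLp_top_of_bound (continuous_planeWave v).aestronglyMeasurable 1
    (Eventually.of_forall fun z => (norm_planeWave v z).le)

/-- Modulation by the character with frequency `v`. -/
noncomputable def modulate (v : ℂ) :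
    Lp ℂ 2 (volume : Measure ℂ) →L[ℂ] Lp ℂ 2 (volume : Measure ℂ) :=
  mulBounded (planeWave v) (memLp_planeWave v)

theorem norm_modulate_le (v : ℂ) (f : Lp ℂ 2 (volume : Measure ℂ)) : ‖modulate v f‖ ≤ ‖f‖ := by
  simpa [modulate] using norm_mulBounded_le (memLp_planeWave v) (fun z => (norm_planeWave v z).le) f

theorem fourierInv_compSubConst (g : SchwartzMap ℂ ℂ) (v z : ℂ) :
    (𝓕⁻ (g.compSubConstCLM ℂ v)) z = planeWave v z * (𝓕⁻ g) z := by
  rw [SchwartzMap.fourierInv_coe, SchwartzMap.fourierInv_coe, Real.fourierInv_eq,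
    Real.fourierInv_eq, ← integral_add_right_eq_self _ v, ← integral_const_mul]
  congr 1 with ξ
  simp only [SchwartzMap.compSubConstCLM_apply, add_sub_cancel_right, planeWave, Circle.smul_def,
    inner_add_left, smul_eq_mul, real_inner_comm v z, AddChar.map_add_eq_mul, Circle.coe_mul]
  ring

theorem fourier_modulate_toLp (g : SchwartzMap ℂ ℂ) (v : ℂ) :
    𝓕 (modulate v ((𝓕⁻ g).toLp 2)) = (g.compSubConstCLM ℂ v).toLp 2 := by
  have h : modulate v ((𝓕⁻ g).toLp 2) = (𝓕⁻ (g.compSubConstCLM ℂ v)).toLp 2 := by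
    apply Lp.ext
    filter_upwards [coeFn_mulBounded _ (memLp_planeWave v) ((𝓕⁻ g).toLp 2),
      (𝓕⁻ g).coeFn_toLp 2, (𝓕⁻ (g.compSubConstCLM ℂ v)).coeFn_toLp 2] with z h1 h2 h3
    rw [modulate, h1, h2, h3, fourierInv_compSubConst]
  rw [h, ← SchwartzMap.toLp_fourierInv_eq, FourierTransform.fourier_fourierInv_eq]

theorem tendsto_apply_zero_of_denseRange {ι F : Type*} [NormedAddCommGroup F] [NormedSpace ℂ F]
    {A : ℕ → F →L[ℂ] F} {C : ℝ} (hA : ∀ N f, ‖A N f‖ ≤ C * ‖f‖) {i : ι → F} (hi : DenseRange i)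
    (h : ∀ g, Tendsto (fun N => A N (i g)) atTop (𝓝 0)) (f : F) :
    Tendsto (fun N => A N f) atTop (𝓝 0) := by
  rw [Metric.tendsto_nhds]
  intro ε hε
  obtain ⟨g, hg⟩ := hi.exists_dist_lt f (ε := ε / (2 * (|C| + 1))) (by positivity)
  filter_upwards [(Metric.tendsto_nhds.1 (h g)) (ε / 2) (by positivity)] with N hN
  rw [dist_zero_right] at hN ⊢
  rw [dist_eq_norm, lt_div_iff₀ (by positivity)] at hg
  have h1 : ‖A N (f - i g)‖ ≤ (|C| + 1) * ‖f - i g‖ :=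
    (hA N _).trans (by gcongr; linarith [le_abs_self C])
  calc ‖A N f‖ = ‖A N (f - i g) + A N (i g)‖ := by rw [← map_add, sub_add_cancel]
    _ ≤ ‖A N (f - i g)‖ + ‖A N (i g)‖ := norm_add_le _ _
    _ < ε := by linarith

/-- Modulation translates the Fourier transform by `v N`. Moving the translation onto the symbol
turns the squared norm into the integral of `|w (ξ + v N) g ξ|²`, which vanishes in the limit by
dominated convergence. The uniform operator bound reduces everything to Schwartz functions. -/
theorem tendsto_multiplierCLM_modulate {w : ℂ → ℂ} (hw : MemLp w ∞ (volume : Measure ℂ))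
    (hwm : Measurable w) {C : ℝ} (hC : ∀ ξ, ‖w ξ‖ ≤ C) {v : ℕ → ℂ}
    (hv : ∀ ξ, Tendsto (fun N => w (ξ + v N)) atTop (𝓝 0)) (f : Lp ℂ 2 (volume : Measure ℂ)) :
    Tendsto (fun N => multiplierCLM w hw (modulate (v N) f)) atTop (𝓝 0) := by
  have hC0 : 0 ≤ C := (norm_nonneg _).trans (hC 0)
  refine tendsto_apply_zero_of_denseRange (A := fun N => multiplierCLM w hw ∘L modulate (v N))
    (C := C) (fun N f => (norm_multiplierCLM_le hw hC _).trans
      (mul_le_mul_of_nonneg_left (norm_modulate_le _ _) hC0))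
    (SchwartzMap.denseRange_toLpCLM (E := ℂ) (F := ℂ) (p := 2) (μ := volume)
      ENNReal.ofNat_ne_top) (fun h => ?_) f
  obtain ⟨g, rfl⟩ : ∃ g : SchwartzMap ℂ ℂ, 𝓕⁻ g = h :=
    ⟨𝓕 h, FourierTransform.fourierInv_fourier_eq h⟩
  have key : ∀ N, ‖multiplierCLM w hw (modulate (v N) ((𝓕⁻ g).toLp 2))‖ₑ =
      (∫⁻ ξ, ‖w (ξ + v N) * g ξ‖ₑ ^ (2 : ℝ)) ^ (1 / 2 : ℝ) := by
    intro N
    have h1 : ‖multiplierCLM w hw (modulate (v N) ((𝓕⁻ g).toLp 2))‖ₑ =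
        ‖mulBounded w hw ((g.compSubConstCLM ℂ (v N)).toLp 2)‖ₑ := by
      rw [← ofReal_norm, ← ofReal_norm, norm_multiplierCLM, fourier_modulate_toLp]
    rw [h1, Lp.enorm_def, eLpNorm_congr_ae (g := fun ξ => w ξ * g (ξ - v N)),
      eLpNorm_eq_lintegral_rpow_enorm_toReal (by simp) (by simp),
      ← lintegral_add_right_eq_self _ (v N)]
    · simp
    · filter_upwards [coeFn_mulBounded w hw ((g.compSubConstCLM ℂ (v N)).toLp 2),
        (g.compSubConstCLM ℂ (v N)).coeFn_toLp 2] with z h2 h3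
      rw [h2, h3, SchwartzMap.compSubConstCLM_apply]
  have lim : Tendsto (fun N => ∫⁻ ξ, ‖w (ξ + v N) * g ξ‖ₑ ^ (2 : ℝ)) atTop (𝓝 (∫⁻ _ : ℂ, 0)) := by
    refine tendsto_lintegral_of_dominated_convergence
      (fun ξ => ‖(C : ℂ) * g ξ‖ₑ ^ (2 : ℝ)) (fun N => ?_) (fun N => ?_) ?_ ?_
    · have := g.continuous.measurable
      fun_prop
    · refine Eventually.of_forall fun ξ => ?_
      dsimp only
      gcongr
      rw [enorm_mul, enorm_mul]
      gcongr
      rw [← ofReal_norm, ← ofReal_norm]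
      apply ENNReal.ofReal_le_ofReal
      simpa [abs_of_nonneg hC0] using hC (ξ + v N)
    · have h2 : MemLp (fun ξ => (C : ℂ) * g ξ) 2 (volume : Measure ℂ) :=
        (g.memLp 2 volume).const_mul _
      have h3 := h2.2
      rw [eLpNorm_eq_lintegral_rpow_enorm_toReal (by simp) (by simp)] at h3
      have h4 := ENNReal.rpow_lt_top_iff_of_pos (x := ∫⁻ ξ, ‖(C : ℂ) * g ξ‖ₑ ^ (2 : ℝ))
        (y := 1 / 2) (by norm_num)
      exact (h4.1 (by simpa using h3)).ne
    · refine Eventually.of_forall fun ξ => ?_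
      have h2 : Tendsto (fun N => w (ξ + v N) * g ξ) atTop (𝓝 0) := by
        simpa using (hv ξ).mul_const (g ξ)
      simpa [Function.comp_def] using
        (ENNReal.continuous_rpow_const (y := 2)).tendsto _ |>.comp h2.enorm
  have lim2 : Tendsto (fun N => ‖multiplierCLM w hw (modulate (v N) ((𝓕⁻ g).toLp 2))‖ₑ) atTop
      (𝓝 0) := by
    simp_rw [key]
    simpa [Function.comp_def] using
      (ENNReal.continuous_rpow_const (y := 1 / 2)).tendsto _ |>.comp lim
  rw [tendsto_zero_iff_norm_tendsto_zero]
  have := (ENNReal.tendsto_toReal (by simp)).comp lim2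
  simpa [Function.comp_def] using this

theorem tendsto_inner_modulate {E : Set ℂ} (hE : MeasurableSet E) (hE' : volume E ≠ ∞) {v : ℕ → ℂ}
    (hv : Tendsto v atTop (cocompact ℂ)) :
    Tendsto (fun N => inner ℂ (indicatorConstLp 2 hE hE' (1 : ℂ))
      (modulate (v N) (indicatorConstLp 2 hE hE' (1 : ℂ)))) atTop (𝓝 0) := by
  -- Riemann–Lebesgue lemma; the reflection accounts for the sign in the exponent.
  have h := (tendsto_integral_exp_inner_smul_cocompact (E.indicator (fun _ => (1 : ℂ)))).comp
    ((Homeomorph.neg ℂ).isClosedEmbedding.tendsto_cocompact.comp hv)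
  refine h.congr fun N => ?_
  rw [L2.inner_def]
  apply integral_congr_ae
  filter_upwards [coeFn_mulBounded _ (memLp_planeWave (v N)) (indicatorConstLp 2 hE hE' (1 : ℂ)),
    indicatorConstLp_coeFn (p := 2) (hs := hE) (hμs := hE') (c := (1 : ℂ))] with z h1 h2
  rw [modulate, h1, h2]
  by_cases hz : z ∈ E <;> simp [hz, planeWave, Circle.smul_def]

/-! ### Integrals of periodic profiles over the disc. -/

-- Multiplication by `N` preserves the measure of the circle, and `(-1, 1]` consists of two periods.
-- This makes the later estimates uniform in `N`.
open AddCircle in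
theorem lintegral_Ioc_comp_natMul {h : UnitAddCircle → ℝ≥0∞} (hh : Measurable h) {N : ℕ}
    (hN : 1 < N) :
    ∫⁻ x in Set.Ioc (-1 : ℝ) 1, h (((N : ℝ) * x : ℝ) : UnitAddCircle) =
      2 * ∫⁻ t, h t ∂haarAddCircle := by
  have hN' : MeasurePreserving (fun y : UnitAddCircle => N • y) volume volume :=
    (AddCircle.ergodic_nsmul hN).toMeasurePreserving
  have key : ∀ a : ℝ, ∫⁻ x in Set.Ioc a (a + 1), h (((N : ℝ) * x : ℝ) : UnitAddCircle) =
      ∫⁻ t, h t ∂haarAddCircle := by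
    intro a
    have h1 := AddCircle.lintegral_preimage (1 : ℝ) a (fun y => h (N • y))
    have h2 : ∀ x : ℝ, (((N : ℝ) * x : ℝ) : UnitAddCircle) = N • (x : UnitAddCircle) := by
      intro x
      rw [← AddCircle.coe_nsmul, nsmul_eq_mul]
    simp_rw [h2]
    rw [h1, hN'.lintegral_comp hh, volume_eq_smul_haarAddCircle]
    simp
  have h0 := key (-1)
  have h1 := key 0
  rw [show (-1 : ℝ) + 1 = 0 by norm_num] at h0
  rw [zero_add] at h1
  rw [← Set.Ioc_union_Ioc_eq_Ioc (show (-1 : ℝ) ≤ 0 by norm_num) zero_le_one,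
    lintegral_union measurableSet_Ioc (Set.Ioc_disjoint_Ioc_of_le le_rfl), h0, h1, two_mul]

/-- The disc lies in the square `(-1, 1]²`; Fubini leaves the side length 2 as a factor. -/
theorem setLIntegral_ball_re_le {k : ℝ → ℝ≥0∞} (hk : Measurable k) :
    ∫⁻ z in Metric.ball (0 : ℂ) 1, k z.re ≤ 2 * ∫⁻ x in Set.Ioc (-1 : ℝ) 1, k x := by
  have hsub : Metric.ball (0 : ℂ) 1 ⊆
      Complex.measurableEquivRealProd ⁻¹' (Set.Ioc (-1) 1 ×ˢ Set.Ioc (-1) 1) := by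
    intro z hz
    rw [mem_ball_zero_iff] at hz
    have h1 := abs_lt.1 ((Complex.abs_re_le_norm z).trans_lt hz)
    have h2 := abs_lt.1 ((Complex.abs_im_le_norm z).trans_lt hz)
    exact ⟨⟨h1.1, h1.2.le⟩, ⟨h2.1, h2.2.le⟩⟩
  calc ∫⁻ z in Metric.ball (0 : ℂ) 1, k z.re
      ≤ ∫⁻ z in Complex.measurableEquivRealProd ⁻¹' (Set.Ioc (-1) 1 ×ˢ Set.Ioc (-1) 1),
          k (Complex.measurableEquivRealProd z).1 := lintegral_mono_set hsub
    _ = ∫⁻ p in Set.Ioc (-1 : ℝ) 1 ×ˢ Set.Ioc (-1 : ℝ) 1, k p.1 :=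
        Complex.volume_preserving_equiv_real_prod.setLIntegral_comp_preimage
          (measurableSet_Ioc.prod measurableSet_Ioc) (hk.comp measurable_fst)
    _ = 2 * ∫⁻ x in Set.Ioc (-1 : ℝ) 1, k x := by
        rw [Measure.volume_eq_prod, ← Measure.prod_restrict,
          lintegral_prod (fun p : ℝ × ℝ => k p.1) (hk.comp measurable_fst).aemeasurable]
        simp only [lintegral_const, Measure.restrict_apply_univ, Real.volume_Ioc]
        rw [lintegral_mul_const _ hk, mul_comm]
        norm_num

/-- The rotation taking 1 to `e` preserves the disc and its measure. -/
theorem setLIntegral_ball_inner_eq {k : ℝ → ℝ≥0∞} (hk : Measurable k) {e : ℂ} (he : ‖e‖ = 1) :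
    ∫⁻ z in Metric.ball (0 : ℂ) 1, k (inner ℝ z e) = ∫⁻ z in Metric.ball (0 : ℂ) 1, k z.re := by
  let ρ := rotation ⟨e, mem_sphere_zero_iff_norm.2 he⟩
  have hρ : ∀ z, ρ z = e * z := fun z => rfl
  have h1 := (ρ.measurePreserving).setLIntegral_comp_preimage
    (Metric.isOpen_ball (x := (0 : ℂ)) (ε := 1)).measurableSet
    (f := fun z => k (inner ℝ z e)) (by fun_prop)
  have h2 : ρ ⁻¹' Metric.ball (0 : ℂ) 1 = Metric.ball (0 : ℂ) 1 := by
    ext z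
    simp
  have h3 : ∀ z : ℂ, inner ℝ (ρ z) e = z.re := by
    intro z
    have h4 : e.re * e.re + e.im * e.im = 1 := by
      rw [← Complex.normSq_apply, Complex.normSq_eq_norm_sq, he, one_pow]
    rw [hρ, Complex.inner]
    simp
    linear_combination z.re * h4
  rw [← h1, h2]
  simp_rw [h3]

open AddCircle in
theorem setLIntegral_ball_comp_inner_le {h : UnitAddCircle → ℝ≥0∞} (hh : Measurable h) {e : ℂ}
    (he : ‖e‖ = 1) {N : ℕ} (hN : 1 < N) :
    ∫⁻ z in Metric.ball (0 : ℂ) 1, h (((N : ℝ) * inner ℝ z e : ℝ) : UnitAddCircle) ≤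
      4 * ∫⁻ t, h t ∂haarAddCircle := by
  have hk : Measurable fun x : ℝ => h (((N : ℝ) * x : ℝ) : UnitAddCircle) :=
    hh.comp (AddCircle.measurable_mk'.comp (measurable_const_mul _))
  rw [setLIntegral_ball_inner_eq hk he]
  refine (setLIntegral_ball_re_le hk).trans_eq ?_
  rw [lintegral_Ioc_comp_natMul hh hN, ← mul_assoc]
  norm_num

/-! ### Stripes and their Fourier expansion. -/

/-- The union of parallel stripes orthogonal to `e`, of period `1 / N`, with profile `A`. -/
def stripes (A : Set UnitAddCircle) (e : ℂ) (N : ℕ) : Set ℂ :=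
  {z | (((N : ℝ) * inner ℝ z e : ℝ) : UnitAddCircle) ∈ A}

theorem measurableSet_stripes {A : Set UnitAddCircle} (hA : MeasurableSet A) (e : ℂ) (N : ℕ) :
    MeasurableSet (stripes A e N) := by
  have h : Measurable fun z : ℂ => (((N : ℝ) * inner ℝ z e : ℝ) : UnitAddCircle) :=
    AddCircle.measurable_mk'.comp (by fun_prop)
  exact h hA

theorem planeWave_eq_fourier (e z : ℂ) (N : ℕ) (l : ℤ) :
    planeWave (((N : ℝ) * l : ℝ) • e) z =
      fourier l (((N : ℝ) * inner ℝ z e : ℝ) : UnitAddCircle) := by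
  rw [fourier_coe_apply, planeWave, Real.fourierChar_apply, inner_smul_right]
  congr 1
  push_cast
  ring

theorem measure_ne_top_of_subset_ball {E : Set ℂ} (h : E ⊆ Metric.ball (0 : ℂ) 1) :
    volume E ≠ ∞ :=
  ((measure_mono h).trans_lt measure_ball_lt_top).ne

-- An L² bound independent of `N`, which controls the tail of the Fourier series of the stripe
-- profile. The constant 2 is the square root of the 4 in `setLIntegral_ball_comp_inner_le`.
open AddCircle in
theorem norm_oscillation_le {q : UnitAddCircle → ℂ} (hq : MemLp q 2 haarAddCircle)
    (hqm : Measurable q)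
    {e : ℂ} (he : ‖e‖ = 1) {E : Set ℂ} (hEb : E ⊆ Metric.ball (0 : ℂ) 1) {N : ℕ} (hN : 1 < N)
    {R : Lp ℂ 2 (volume : Measure ℂ)}
    (hR : R =ᵐ[volume] fun z => q (((N : ℝ) * inner ℝ z e : ℝ) : UnitAddCircle) *
      E.indicator (fun _ => (1 : ℂ)) z) :
    ‖R‖ ≤ 2 * ‖hq.toLp q‖ := by
  rw [Lp.norm_def, Lp.norm_toLp, ← ENNReal.toReal_ofNat, ← ENNReal.toReal_mul]
  apply ENNReal.toReal_mono (ENNReal.mul_ne_top (by simp) hq.eLpNorm_ne_top)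
  rw [eLpNorm_congr_ae hR, eLpNorm_eq_lintegral_rpow_enorm_toReal (by simp) (by simp),
    eLpNorm_eq_lintegral_rpow_enorm_toReal (by simp) (by simp)]
  have h4 : (2 : ℝ≥0∞) = (4 : ℝ≥0∞) ^ (1 / (2 : ℝ≥0∞).toReal) := by
    rw [show (4 : ℝ≥0∞) = 2 ^ (2 : ℝ) by norm_num, ← ENNReal.rpow_mul]
    norm_num
  conv_rhs => arg 1; rw [h4]
  rw [← ENNReal.mul_rpow_of_nonneg _ _ (by positivity)]
  gcongr
  refine le_trans ?_ (setLIntegral_ball_comp_inner_le (h := fun t => ‖q t‖ₑ ^ (2 : ℝ≥0∞).toReal)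
    (by fun_prop) he hN)
  rw [← lintegral_indicator Metric.isOpen_ball.measurableSet]
  refine lintegral_mono fun z => ?_
  by_cases hz : z ∈ E
  · simp [hz, hEb hz]
  · simp [hz]

-- The centred profile `1_A - θ` is expanded in its Fourier series on the circle. Each nonzero
-- frequency gives a modulation of `1_E`, which `L` kills in the limit, and the tail is small
-- uniformly in `N`.
open AddCircle in
theorem tendsto_apply_stripes {G : Type*} [NormedAddCommGroup G] [NormedSpace ℂ G]
    (L : Lp ℂ 2 (volume : Measure ℂ) →L[ℂ] G) {e : ℂ} (he : ‖e‖ = 1) {A : Set UnitAddCircle}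
    (hA : MeasurableSet A) {E : Set ℂ} (hE : MeasurableSet E) (hE' : volume E ≠ ∞)
    (hEb : E ⊆ Metric.ball (0 : ℂ) 1)
    (h : ∀ l : ℤ, l ≠ 0 → Tendsto (fun N : ℕ => L (modulate (((N : ℝ) * l : ℝ) • e)
      (indicatorConstLp 2 hE hE' (1 : ℂ)))) atTop (𝓝 0)) :
    Tendsto (fun N : ℕ => L (indicatorConstLp 2 (hE.inter (measurableSet_stripes hA e N))
        (measure_inter_ne_top_of_left_ne_top hE') (1 : ℂ) -
      ((haarAddCircle.real A : ℝ) : ℂ) • indicatorConstLp 2 hE hE' (1 : ℂ))) atTop (𝓝 0) := by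
  set θ : ℝ := haarAddCircle.real A
  set φ : UnitAddCircle → ℂ := fun t => A.indicator (fun _ => (1 : ℂ)) t - θ with hφ
  have hφm : Measurable φ := (measurable_const.indicator hA).sub_const _
  have hφL : MemLp φ 2 haarAddCircle :=
    (memLp_indicator_const 2 hA (1 : ℂ) (Or.inr (by finiteness))).sub (memLp_const _)
  set Φ := hφL.toLp φ
  have hsum := hasSum_fourier_series_L2 Φ
  -- The profile has mean zero, which removes the one frequency about which `h` says nothing.
  have h0 : fourierCoeff Φ 0 = 0 := by
    rw [fourierCoeff_congr_ae hφL.coeFn_toLp, fourierCoeff]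
    simp only [neg_zero, fourier_zero, one_smul, hφ]
    rw [integral_sub ((integrable_const _).indicator hA) (integrable_const _),
      integral_indicator hA]
    simp [θ]
  rw [Metric.tendsto_nhds]
  intro ε hε
  -- Chosen so that a tail of L² norm below `δ`, doubled by `norm_oscillation_le`, contributes less
  -- than `ε / 2` after applying `L`.
  set δ : ℝ := ε / (4 * (‖L‖ + 1))
  have hδ : 0 < δ := by positivity
  obtain ⟨s, hs⟩ := (Metric.tendsto_nhds.1 hsum δ hδ).exists
  have hfin : Tendsto (fun N : ℕ => L (∑ l ∈ s, fourierCoeff Φ l •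
      modulate (((N : ℝ) * l : ℝ) • e) (indicatorConstLp 2 hE hE' (1 : ℂ)))) atTop (𝓝 0) := by
    simp_rw [map_sum, map_smul]
    suffices Tendsto (fun N : ℕ => ∑ l ∈ s, fourierCoeff Φ l • L (modulate (((N : ℝ) * l : ℝ) • e)
        (indicatorConstLp 2 hE hE' (1 : ℂ)))) atTop (𝓝 (∑ l ∈ s, 0)) by
      rwa [Finset.sum_const_zero] at this
    refine tendsto_finsetSum _ fun l _ => ?_
    by_cases hl : l = 0
    · simp [hl, h0]
    · simpa using (h l hl).const_smul (fourierCoeff Φ l)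
  filter_upwards [Metric.tendsto_nhds.1 hfin (ε / 2) (by positivity), eventually_gt_atTop 1]
    with N h1 hN
  set q : UnitAddCircle → ℂ := fun t => φ t - ∑ l ∈ s, fourierCoeff Φ l * fourier l t
  have hqm : Measurable q := by
    have : ∀ l : ℤ, Measurable fun t : UnitAddCircle => fourier l t := fun l =>
      (fourier l).continuous.measurable
    fun_prop
  have hqe : q =ᵐ[haarAddCircle] (Φ - ∑ l ∈ s, fourierCoeff Φ l • fourierLp 2 l :
      Lp ℂ 2 (@haarAddCircle 1 _)) := by
    have h2 : ∀ l : ℤ, ((fourierCoeff Φ l • fourierLp 2 l : Lp ℂ 2 (@haarAddCircle 1 _)) :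
        UnitAddCircle → ℂ) =ᵐ[haarAddCircle] fun t => fourierCoeff Φ l * fourier l t := by
      intro l
      filter_upwards [Lp.coeFn_smul (fourierCoeff Φ l) (fourierLp (T := 1) 2 l),
        coeFn_fourierLp (T := 1) 2 l] with t h3 h4
      rw [h3, Pi.smul_apply, h4, smul_eq_mul]
    filter_upwards [hφL.coeFn_toLp, Lp.coeFn_sub Φ (∑ l ∈ s, fourierCoeff Φ l • fourierLp 2 l),
      Lp.coeFn_finsetSum s (fun l => fourierCoeff Φ l • fourierLp (T := 1) 2 l),
      ae_all_iff.2 h2] with t h3 h4 h5 h6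
    rw [h4, Pi.sub_apply, h5, h3, Finset.sum_apply]
    simp_rw [h6]
    rfl
  have hqL : MemLp q 2 haarAddCircle := (memLp_congr_ae hqe).2 (Lp.memLp _)
  have hqn : ‖hqL.toLp q‖ < δ := by
    have : hqL.toLp q = Φ - ∑ l ∈ s, fourierCoeff Φ l • fourierLp 2 l :=
      Lp.ext (hqL.coeFn_toLp.trans hqe)
    rwa [this, ← dist_eq_norm, dist_comm]
  set ind := indicatorConstLp 2 hE hE' (1 : ℂ)
  set D := indicatorConstLp 2 (hE.inter (measurableSet_stripes hA e N))
        (measure_inter_ne_top_of_left_ne_top hE') (1 : ℂ) - (θ : ℂ) • ind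
  set S := ∑ l ∈ s, fourierCoeff Φ l • modulate (((N : ℝ) * l : ℝ) • e) ind
  have hRn : ‖D - S‖ ≤ 2 * ‖hqL.toLp q‖ := by
    refine norm_oscillation_le hqL hqm he hEb hN ?_
    have h2 : ∀ l : ℤ, ((fourierCoeff Φ l • modulate (((N : ℝ) * l : ℝ) • e) ind :
        Lp ℂ 2 (volume : Measure ℂ)) : ℂ → ℂ) =ᵐ[volume] fun z => fourierCoeff Φ l *
          (fourier l (((N : ℝ) * inner ℝ z e : ℝ) : UnitAddCircle) * ind z) := by
      intro l
      filter_upwards [Lp.coeFn_smul (fourierCoeff Φ l) (modulate (((N : ℝ) * l : ℝ) • e) ind),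
        coeFn_mulBounded _ (memLp_planeWave (((N : ℝ) * l : ℝ) • e)) ind] with z h3 h4
      rw [h3, Pi.smul_apply, modulate, h4, smul_eq_mul, planeWave_eq_fourier]
    filter_upwards [Lp.coeFn_sub D S, ae_all_iff.2 h2,
      Lp.coeFn_sub (indicatorConstLp 2 (hE.inter (measurableSet_stripes hA e N))
        (measure_inter_ne_top_of_left_ne_top hE') (1 : ℂ)) ((θ : ℂ) • ind),
      Lp.coeFn_smul (θ : ℂ) ind,
      Lp.coeFn_finsetSum s
        (fun l => fourierCoeff Φ l • modulate (((N : ℝ) * l : ℝ) • e) ind),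
      indicatorConstLp_coeFn (p := 2) (hs := hE) (hμs := hE') (c := (1 : ℂ)),
      indicatorConstLp_coeFn (p := 2) (hs := hE.inter (measurableSet_stripes hA e N))
        (hμs := measure_inter_ne_top_of_left_ne_top hE') (c := (1 : ℂ))]
      with z h3 h4 h5 h6 h7 h8 h9
    rw [h3, Pi.sub_apply, h5, Pi.sub_apply, h6, Pi.smul_apply, h7, Finset.sum_apply, h9]
    simp_rw [h4]
    rw [h8]
    have hst : A.indicator (fun _ => (1 : ℂ)) (((N : ℝ) * inner ℝ z e : ℝ) : UnitAddCircle) =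
        (stripes A e N).indicator (fun _ => (1 : ℂ)) z := rfl
    simp only [q, φ, hst]
    by_cases hz : z ∈ E <;> by_cases hz' : z ∈ stripes A e N <;> simp [hz, hz']
  rw [dist_zero_right] at h1 ⊢
  have h5 : ‖L (D - S)‖ < ε / 2 := by
    have hLe : ‖L‖ * ‖D - S‖ ≤ (‖L‖ + 1) * (2 * ‖hqL.toLp q‖) := by gcongr; linarith
    have hδe : δ * (4 * (‖L‖ + 1)) = ε := div_mul_cancel₀ _ (by positivity)
    nlinarith [L.le_opNorm (D - S), norm_nonneg L]
  calc ‖L D‖ = ‖L (D - S) + L S‖ := by rw [← map_add, sub_add_cancel]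
    _ ≤ ‖L (D - S)‖ + ‖L S‖ := norm_add_le _ _
    _ < ε := by linarith

open AddCircle in
theorem exists_haarAddCircle_eq {θ : ℝ} (h0 : 0 ≤ θ) (h1 : θ ≤ 1) :
    ∃ A : Set UnitAddCircle, MeasurableSet A ∧ haarAddCircle.real A = θ := by
  refine ⟨Metric.closedBall 0 (θ / 2), Metric.isClosed_closedBall.measurableSet, ?_⟩
  have h := AddCircle.volume_closedBall (1 : ℝ) (x := 0) (θ / 2)
  rw [volume_eq_smul_haarAddCircle] at h
  simp only [ENNReal.ofReal_one, one_smul] at h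
  rw [measureReal_def, h, mul_div_cancel₀ _ two_ne_zero, min_eq_right h1, ENNReal.toReal_ofReal h0]

/-! ### One lamination step. -/

/-- The symbol `m` has the limit `s` along every arithmetic progression `ξ + N l e`, `l ≠ 0`, where
`e` is a unit vector. -/
structure HasDirectionalLimit (m : ℂ → ℂ) (e : ℂ) (s : ℂ) : Prop where
  norm_eq_one : ‖e‖ = 1
  tendsto : ∀ (l : ℤ), l ≠ 0 → ∀ ξ : ℂ,
    Tendsto (fun N : ℕ => m (ξ + ((N : ℝ) * l : ℝ) • e)) atTop (𝓝 s)

theorem tendsto_smul_cocompact {e : ℂ} (he : ‖e‖ = 1) {l : ℤ} (hl : l ≠ 0) :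
    Tendsto (fun N : ℕ => ((N : ℝ) * l : ℝ) • e) atTop (cocompact ℂ) := by
  rw [← Metric.cobounded_eq_cocompact, ← comap_norm_atTop, tendsto_comap_iff]
  have : ∀ N : ℕ, ‖((N : ℝ) * l : ℝ) • e‖ = (N : ℝ) * |(l : ℝ)| := by
    intro N
    rw [norm_smul, he, mul_one, norm_mul, Real.norm_eq_abs, Real.norm_eq_abs, Nat.abs_cast]
  simp only [Function.comp_def, this]
  exact tendsto_natCast_atTop_atTop.atTop_mul_const (by positivity)

/-- Every subset `E` of the disc can be intersected with fine stripes so that a proportion `θ` of it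
remains and the multiplier acts almost as the constant `s` on the oscillating part. -/
theorem exists_subset_norm_multiplier_le {m : ℂ → ℂ} (hm : MemLp m ∞ (volume : Measure ℂ))
    (hmm : Measurable m) {C : ℝ} (hC : ∀ ξ, ‖m ξ‖ ≤ C) {e s : ℂ} (hs : HasDirectionalLimit m e s)
    {θ : ℝ} (h0 : 0 ≤ θ) (h1 : θ ≤ 1) {E : Set ℂ} (hE : MeasurableSet E) (hE' : volume E ≠ ∞)
    (hEb : E ⊆ Metric.ball (0 : ℂ) 1) {ε : ℝ} (hε : 0 < ε) :
    ∃ (E₁ : Set ℂ) (hE₁ : MeasurableSet E₁) (hE₁' : volume E₁ ≠ ∞), E₁ ⊆ E ∧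
      |volume.real E₁ - θ * volume.real E| ≤ ε ∧
      ‖multiplierCLM m hm (indicatorConstLp 2 hE₁ hE₁' (1 : ℂ) -
          (θ : ℂ) • indicatorConstLp 2 hE hE' (1 : ℂ)) -
        s • (indicatorConstLp 2 hE₁ hE₁' (1 : ℂ) -
          (θ : ℂ) • indicatorConstLp 2 hE hE' (1 : ℂ))‖ ≤ ε := by
  obtain ⟨A, hA, rfl⟩ := exists_haarAddCircle_eq h0 h1
  have hwm : Measurable fun ξ => m ξ - s := hmm.sub_const s
  have hwC : ∀ ξ, ‖m ξ - s‖ ≤ C + ‖s‖ := fun ξ =>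
    (norm_sub_le _ _).trans (by gcongr; exact hC ξ)
  have hw : MemLp (fun ξ => m ξ - s) ∞ (volume : Measure ℂ) :=
    memLp_top_of_bound hwm.aestronglyMeasurable _ (Eventually.of_forall hwC)
  have lim1 := tendsto_apply_stripes (multiplierCLM _ hw) hs.norm_eq_one hA hE hE' hEb
    fun l hl => tendsto_multiplierCLM_modulate hw hwm hwC
      (fun ξ => by simpa using (hs.tendsto l hl ξ).sub_const s) _
  -- Pairing with `1_E` reads off the measure of the cut set; `lim1` handles the multiplier with
  -- symbol `m - s`. One large `N` serves both.
  have lim2 := tendsto_apply_stripes (innerSL ℂ (indicatorConstLp 2 hE hE' (1 : ℂ)))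
    hs.norm_eq_one hA hE hE' hEb
    fun l hl => by
      simpa using tendsto_inner_modulate hE hE' (tendsto_smul_cocompact hs.norm_eq_one hl)
  obtain ⟨N, hN1, hN2⟩ := ((Metric.tendsto_nhds.1 lim1 ε hε).and
    (Metric.tendsto_nhds.1 lim2 ε hε)).exists
  refine ⟨E ∩ stripes A e N, hE.inter (measurableSet_stripes hA e N),
    measure_inter_ne_top_of_left_ne_top hE', Set.inter_subset_left, ?_, ?_⟩
  · rw [dist_zero_right, innerSL_apply_apply, inner_sub_right, inner_smul_right] at hN2
    have hin : ∀ {F : Set ℂ} (hF : MeasurableSet F) (hF' : volume F ≠ ∞), F ⊆ E →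
        inner ℂ (indicatorConstLp 2 hE hE' (1 : ℂ)) (indicatorConstLp 2 hF hF' (1 : ℂ)) =
          ((volume.real F : ℝ) : ℂ) := by
      intro F hF hF' hFE
      rw [L2.inner_indicatorConstLp_indicatorConstLp]
      rw [Set.inter_eq_right.2 hFE]
      simp
    rw [hin _ _ Set.inter_subset_left, hin _ _ subset_rfl, ← Complex.ofReal_mul,
      ← Complex.ofReal_sub, Complex.norm_real, Real.norm_eq_abs] at hN2
    exact hN2.le
  · rw [dist_zero_right, multiplierCLM_sub_const hm s hw] at hN1
    exact hN1.le

/-! ### Iterated laminations. -/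

/-- Measurable subsets of the open unit disc. -/
abbrev DiscSet : Type := {E : Set ℂ // MeasurableSet E ∧ E ⊆ Metric.ball (0 : ℂ) 1}

/-- The indicator function of a subset of the disc, as an element of `L²(ℂ)`. -/
noncomputable def DiscSet.ind (E : DiscSet) : Lp ℂ 2 (volume : Measure ℂ) :=
  indicatorConstLp 2 E.2.1 (measure_ne_top_of_subset_ball E.2.2) (1 : ℂ)

theorem DiscSet.coeFn_ind (E : DiscSet) :
    E.ind =ᵐ[volume] fun z => (((E : Set ℂ).indicator (fun _ => (1 : ℝ)) z : ℝ) : ℂ) := by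
  filter_upwards [indicatorConstLp_coeFn (p := 2) (hs := E.2.1)
    (hμs := measure_ne_top_of_subset_ball E.2.2) (c := (1 : ℂ))] with z hz
  rw [DiscSet.ind, hz]
  by_cases h : z ∈ (E : Set ℂ) <;> simp [h]

/-- A nested sequence of subsets of the disc obtained by laminating in directions in which the
symbol `m` is alternately `1` and `-1`, starting from the disc, keeping a proportion `θ` of the
previous set in each step, up to an error `ε`. -/
structure IsLamination (m : ℂ → ℂ) (hm : MemLp m ∞ (volume : Measure ℂ)) (θ ε : ℝ)
    (E : ℕ → DiscSet) : Prop where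
  zero : (E 0 : Set ℂ) = Metric.ball 0 1
  subset : ∀ k, (E (k + 1) : Set ℂ) ⊆ E k
  measure : ∀ k, |volume.real (E (k + 1) : Set ℂ) - θ * volume.real (E k : Set ℂ)| ≤ ε
  norm : ∀ k, ‖multiplierCLM m hm ((E (k + 1)).ind - (θ : ℂ) • (E k).ind) -
    ((-1) ^ k : ℂ) • ((E (k + 1)).ind - (θ : ℂ) • (E k).ind)‖ ≤ ε

theorem exists_isLamination {m : ℂ → ℂ} (hm : MemLp m ∞ (volume : Measure ℂ)) (hmm : Measurable m)
    {C : ℝ} (hC : ∀ ξ, ‖m ξ‖ ≤ C) (hs : ∀ k : ℕ, ∃ e, HasDirectionalLimit m e ((-1) ^ k)) {θ : ℝ}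
    (h0 : 0 ≤ θ) (h1 : θ ≤ 1) {ε : ℝ} (hε : 0 < ε) : ∃ E, IsLamination m hm θ ε E := by
  have step : ∀ (k : ℕ) (E : DiscSet), ∃ E₁ : DiscSet, (E₁ : Set ℂ) ⊆ E ∧
      |volume.real (E₁ : Set ℂ) - θ * volume.real (E : Set ℂ)| ≤ ε ∧
      ‖multiplierCLM m hm (E₁.ind - (θ : ℂ) • E.ind) -
        ((-1) ^ k : ℂ) • (E₁.ind - (θ : ℂ) • E.ind)‖ ≤ ε := by
    intro k E
    obtain ⟨e, he⟩ := hs k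
    obtain ⟨E₁, hE₁, hE₁', hsub, h2, h3⟩ := exists_subset_norm_multiplier_le hm hmm hC he h0 h1
      E.2.1 (measure_ne_top_of_subset_ball E.2.2) E.2.2 hε
    exact ⟨⟨E₁, hE₁, hsub.trans E.2.2⟩, hsub, h2, h3⟩
  choose next hsub hmeas hnorm using step
  obtain ⟨E, hE0, hE⟩ : ∃ E : ℕ → DiscSet, (E 0 : Set ℂ) = Metric.ball 0 1 ∧
      ∀ k, E (k + 1) = next k (E k) :=
    ⟨fun k => Nat.rec ⟨Metric.ball 0 1, Metric.isOpen_ball.measurableSet, subset_rfl⟩ next k,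
      rfl, fun _ => rfl⟩
  refine ⟨E, hE0, fun k => ?_, fun k => ?_, fun k => ?_⟩ <;> rw [hE]
  exacts [hsub k _, hmeas k _, hnorm k _]

/-! ### Pointwise analysis of the recursion. -/

/-- The solution of the recursion satisfied by the image of the indicator functions in a
lamination under the multiplier. -/
def lamValue (θ : ℝ) (u : ℕ → ℝ) : ℕ → ℝ
  | 0 => 0
  | n + 1 => θ * lamValue θ u n + (-1) ^ n * (u (n + 1) - θ * u n)

/-- A lower bound for `|lamValue θ u n|` outside the last set of a lamination. -/
def lamBound (θ : ℝ) (u : ℕ → ℝ) : ℕ → ℝ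
  | 0 => 0
  | n + 1 => θ * lamBound θ u n + θ ^ 2 * (u n - u (n + 1))

/-- While the point stays in the sets, `p n = (-1)^(n+1) * lamValue θ u n` satisfies `p (n+1) = 1 -
θ - θ p n`, which preserves the interval `[0, 1 - θ]`. At the exit step the inherited value and the
new term have the same sign, so they cannot cancel; afterwards the value is only multiplied by θ.
With a constant sign in place of `(-1)^n` the two terms would nearly cancel. -/
theorem lamBound_le_abs_lamValue {θ : ℝ} (h0 : 0 ≤ θ) (h1 : θ ≤ 1) {u : ℕ → ℝ} (hu0 : u 0 = 1)
    (hu : ∀ n, u n = 0 ∨ u n = 1) (hanti : ∀ n, u (n + 1) ≤ u n) (n : ℕ) :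
    (u n = 1 ∧ lamBound θ u n = 0 ∧ 0 ≤ (-1) ^ (n + 1) * lamValue θ u n ∧
      (-1) ^ (n + 1) * lamValue θ u n ≤ 1 - θ) ∨
    (u n = 0 ∧ lamBound θ u n ≤ |lamValue θ u n|) := by
  induction n with
  | zero => exact Or.inl ⟨hu0, rfl, by simp [lamValue], by simpa [lamValue] using h1⟩
  | succ n ih =>
    have hsq : ((-1 : ℝ) ^ n) * (-1) ^ n = 1 := by rw [← mul_pow]; norm_num
    rcases ih with ⟨hn, hB, hp, hq⟩ | ⟨hn, hB⟩
    · rw [pow_succ] at hp hq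
      have hB' : lamBound θ u (n + 1) = θ ^ 2 * (1 - u (n + 1)) := by
        rw [lamBound, hB, hn]; ring
      have hV : (-1) ^ n * lamValue θ u (n + 1) =
          u (n + 1) - θ - θ * ((-1) ^ n * (-1) * lamValue θ u n) := by
        rw [lamValue, hn]
        linear_combination (u (n + 1) - θ) * hsq
      rcases hu (n + 1) with h | h
      · right
        refine ⟨h, ?_⟩
        have habs : |lamValue θ u (n + 1)| = |(-1) ^ n * lamValue θ u (n + 1)| := by
          rw [abs_mul, abs_pow, abs_neg, abs_one, one_pow, one_mul]
        rw [habs, hV, hB', h]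
        -- The modulus at exit is `θ + θ p` with `p ≥ 0`; only the weaker `θ ^ 2` is kept, a loss
        -- that disappears as θ → 1.
        refine le_trans ?_ (neg_le_abs _)
        nlinarith [mul_nonneg h0 hp]
      · left
        have hV2 : (-1) ^ (n + 1 + 1) * lamValue θ u (n + 1) =
            (-1) ^ n * lamValue θ u (n + 1) := by ring
        rw [hV2, hV, hB', h]
        refine ⟨rfl, by ring, ?_, ?_⟩ <;> nlinarith [mul_nonneg h0 hp]
    · right
      have h : u (n + 1) = 0 := by
        rcases hu (n + 1) with h | h
        · exact h
        · have := hanti n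
          rw [h, hn] at this
          norm_num at this
      refine ⟨h, ?_⟩
      rw [lamBound, lamValue, h, hn]
      simp only [sub_self, mul_zero, add_zero, abs_mul, abs_of_nonneg h0]
      gcongr

/-- For exactly geometric areas every layer contributes the same amount, whence the factor `n` that
matches the logarithm. -/
theorem lamBound_const_mul_pow (θ c : ℝ) (n : ℕ) :
    lamBound θ (fun k => θ ^ k * c) n = n * θ ^ (n + 1) * (1 - θ) * c := by
  induction n with
  | zero => simp [lamBound]
  | succ n ih =>
    rw [lamBound, ih]
    push_cast
    ring

theorem tendsto_lamBound {θ : ℝ} {u : ℕ → ℕ → ℝ} {v : ℕ → ℝ}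
    (h : ∀ k, Tendsto (fun i => u i k) atTop (𝓝 (v k))) (n : ℕ) :
    Tendsto (fun i => lamBound θ (u i) n) atTop (𝓝 (lamBound θ v n)) := by
  induction n with
  | zero => exact tendsto_const_nhds
  | succ n ih => exact (ih.const_mul θ).add (((h n).sub (h (n + 1))).const_mul _)

theorem integral_lamBound {E : ℕ → DiscSet} (θ : ℝ) (n : ℕ) :
    Integrable (fun z => lamBound θ (fun k => (E k : Set ℂ).indicator (fun _ => (1 : ℝ)) z) n) ∧
    ∫ z, lamBound θ (fun k => (E k : Set ℂ).indicator (fun _ => (1 : ℝ)) z) n =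
      lamBound θ (fun k => volume.real (E k : Set ℂ)) n := by
  have hint : ∀ k, Integrable ((E k : Set ℂ).indicator (fun _ => (1 : ℝ))) := fun k =>
    (integrable_indicator_iff (E k).2.1).2
      (integrableOn_const (measure_ne_top_of_subset_ball (E k).2.2))
  have hval : ∀ k, ∫ z, (E k : Set ℂ).indicator (fun _ => (1 : ℝ)) z =
      volume.real (E k : Set ℂ) := fun k => by
    rw [integral_indicator (E k).2.1]; simp
  induction n with
  | zero => simp [lamBound]
  | succ n ih =>
    have h1 := ih.1.const_mul θ
    have h2 : Integrable fun z => θ ^ 2 * ((E n : Set ℂ).indicator (fun _ => (1 : ℝ)) z -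
        (E (n + 1) : Set ℂ).indicator (fun _ => (1 : ℝ)) z) :=
      ((hint n).sub (hint (n + 1))).const_mul (θ ^ 2)
    refine ⟨h1.add h2, ?_⟩
    simp only [lamBound]
    rw [integral_add h1 h2, integral_const_mul, integral_const_mul, ih.2,
      integral_sub (hint n) (hint (n + 1)), hval, hval]

/-! ### From the recursion to the integral bound. -/

/-- The elements of `L²(ℂ)` that represent `lamValue`. -/
noncomputable def lamLp (θ : ℝ) (E : ℕ → DiscSet) : ℕ → Lp ℂ 2 (volume : Measure ℂ)
  | 0 => 0
  | n + 1 => (θ : ℂ) • lamLp θ E n + ((-1) ^ n : ℂ) • ((E (n + 1)).ind - (θ : ℂ) • (E n).ind)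

theorem coeFn_lamLp (θ : ℝ) (E : ℕ → DiscSet) (n : ℕ) : lamLp θ E n =ᵐ[volume] fun z =>
    ((lamValue θ (fun k => (E k : Set ℂ).indicator (fun _ => (1 : ℝ)) z) n : ℝ) : ℂ) := by
  induction n with
  | zero =>
    exact Eventually.of_forall fun z => by simp [lamValue, lamLp]
  | succ n ih =>
    filter_upwards [ih, (E n).coeFn_ind, (E (n + 1)).coeFn_ind,
      Lp.coeFn_add ((θ : ℂ) • lamLp θ E n)
        (((-1) ^ n : ℂ) • ((E (n + 1)).ind - (θ : ℂ) • (E n).ind)),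
      Lp.coeFn_smul (θ : ℂ) (lamLp θ E n),
      Lp.coeFn_smul ((-1) ^ n : ℂ) ((E (n + 1)).ind - (θ : ℂ) • (E n).ind),
      Lp.coeFn_sub (E (n + 1)).ind ((θ : ℂ) • (E n).ind),
      Lp.coeFn_smul (θ : ℂ) (E n).ind] with z h1 h2 h3 h4 h5 h6 h7 h8
    rw [lamLp, h4, Pi.add_apply, h5, h6, Pi.smul_apply, Pi.smul_apply, h7, Pi.sub_apply, h8,
      Pi.smul_apply, h1, h2, h3, lamValue]
    push_cast
    rfl

/-- Both sequences obey the same recursion up to an error `ε` per step, and the factor `θ ≤ 1` does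
not amplify earlier errors. -/
theorem IsLamination.norm_sub_lamLp_le {m : ℂ → ℂ} {hm : MemLp m ∞ (volume : Measure ℂ)} {θ ε : ℝ}
    {E : ℕ → DiscSet} (hE : IsLamination m hm θ ε E) (h0 : 0 ≤ θ) (h1 : θ ≤ 1) (n : ℕ) :
    ‖multiplierCLM m hm (E n).ind - lamLp θ E n -
      ((θ ^ n : ℝ) : ℂ) • multiplierCLM m hm (E 0).ind‖ ≤ n * ε := by
  induction n with
  | zero => simp [lamLp]
  | succ n ih =>
    have key : multiplierCLM m hm (E (n + 1)).ind - lamLp θ E (n + 1) -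
        ((θ ^ (n + 1) : ℝ) : ℂ) • multiplierCLM m hm (E 0).ind =
        (θ : ℂ) • (multiplierCLM m hm (E n).ind - lamLp θ E n -
          ((θ ^ n : ℝ) : ℂ) • multiplierCLM m hm (E 0).ind) +
        (multiplierCLM m hm ((E (n + 1)).ind - (θ : ℂ) • (E n).ind) -
          ((-1) ^ n : ℂ) • ((E (n + 1)).ind - (θ : ℂ) • (E n).ind)) := by
      rw [lamLp, map_sub, map_smul]
      push_cast
      module
    rw [key]
    have h2 : ‖(θ : ℂ) • (multiplierCLM m hm (E n).ind - lamLp θ E n -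
          ((θ ^ n : ℝ) : ℂ) • multiplierCLM m hm (E 0).ind)‖ ≤ n * ε := by
      rw [norm_smul, Complex.norm_real, Real.norm_eq_abs, abs_of_nonneg h0]
      exact (mul_le_of_le_one_left (norm_nonneg _) h1).trans ih
    refine (norm_add_le _ _).trans ?_
    rw [Nat.cast_succ, add_mul, one_mul]
    exact add_le_add h2 (hE.norm n)

/-- Cauchy–Schwarz on the disc, whose area is π. -/
theorem setIntegral_ball_norm_le (f : Lp ℂ 2 (volume : Measure ℂ)) :
    IntegrableOn f (Metric.ball (0 : ℂ) 1) ∧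
      ∫ z in Metric.ball (0 : ℂ) 1, ‖f z‖ ≤ √Real.pi * ‖f‖ := by
  have hfin : IsFiniteMeasure (volume.restrict (Metric.ball (0 : ℂ) 1)) :=
    ⟨by simp⟩
  have hf : MemLp f 2 (volume.restrict (Metric.ball (0 : ℂ) 1)) := (Lp.memLp f).restrict _
  have hint : IntegrableOn f (Metric.ball (0 : ℂ) 1) := hf.integrable (by norm_num)
  refine ⟨hint, ?_⟩
  have h1 := eLpNorm_le_eLpNorm_mul_rpow_measure_univ (μ := volume.restrict (Metric.ball (0 : ℂ) 1))
    (p := 1) (q := 2) (by norm_num) hf.1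
  rw [integral_norm_eq_lintegral_enorm hint.aestronglyMeasurable, ← eLpNorm_one_eq_lintegral_enorm]
  have h2 : eLpNorm f 2 (volume.restrict (Metric.ball (0 : ℂ) 1)) ≤ eLpNorm f 2 volume :=
    eLpNorm_mono_measure _ Measure.restrict_le_self
  have h3 : volume.restrict (Metric.ball (0 : ℂ) 1) Set.univ ^
      (1 / (1 : ℝ≥0∞).toReal - 1 / (2 : ℝ≥0∞).toReal) = ENNReal.ofReal (√Real.pi) := by
    rw [Measure.restrict_apply_univ, Complex.volume_ball]
    norm_num
    rw [Real.sqrt_eq_rpow, ← ENNReal.ofReal_rpow_of_nonneg Real.pi_pos.le (by norm_num)]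
    norm_num
    rw [ENNReal.ofReal, Real.toNNReal_of_nonneg Real.pi_pos.le]
    rfl
  rw [h3] at h1
  rw [Lp.norm_def, mul_comm, ← ENNReal.toReal_ofReal (Real.sqrt_nonneg Real.pi),
    ← ENNReal.toReal_mul]
  exact ENNReal.toReal_mono (ENNReal.mul_ne_top (Lp.eLpNorm_ne_top f) (by simp))
    (h1.trans (by gcongr))

theorem volume_real_ball : volume.real (Metric.ball (0 : ℂ) 1) = Real.pi := by
  rw [measureReal_def, Complex.volume_ball]
  simp

theorem DiscSet.norm_ind (E : DiscSet) : ‖E.ind‖ = √(volume.real (E : Set ℂ)) := by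
  rw [DiscSet.ind, norm_indicatorConstLp (by simp) (by simp), Real.sqrt_eq_rpow]
  simp

/-- Outside `E n` in the disc, `|T 1_{E n}|` is at least the layer bound minus `|X|`, where `X`
collects `θ^n T 1_{E 0}` and the accumulated errors. The layer bound vanishes on `E n` and off the
disc, so it may be integrated over the whole plane. -/
theorem IsLamination.le_setIntegral {m : ℂ → ℂ} {hm : MemLp m ∞ (volume : Measure ℂ)} {θ ε : ℝ}
    {E : ℕ → DiscSet} (hE : IsLamination m hm θ ε E) (hm1 : ∀ ξ, ‖m ξ‖ ≤ 1) (h0 : 0 ≤ θ)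
    (h1 : θ ≤ 1) (n : ℕ) :
    lamBound θ (fun k => volume.real (E k : Set ℂ)) n - θ ^ n * Real.pi - √Real.pi * (n * ε) ≤
      ∫ z in Metric.ball (0 : ℂ) 1 \ (E n : Set ℂ), ‖multiplierCLM m hm (E n).ind z‖ := by
  set D := Metric.ball (0 : ℂ) 1
  have hD : MeasurableSet D := Metric.isOpen_ball.measurableSet
  have hDE : MeasurableSet (D \ (E n : Set ℂ)) := hD.diff (E n).2.1
  set T := multiplierCLM m hm
  set P := lamLp θ E n
  set X := T (E n).ind - P
  set B : ℂ → ℝ := fun z => lamBound θ (fun k => (E k : Set ℂ).indicator (fun _ => (1 : ℝ)) z) n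
  have hX : ‖X‖ ≤ θ ^ n * √Real.pi + n * ε := by
    have h2 := hE.norm_sub_lamLp_le h0 h1 n
    have h3 : ‖((θ ^ n : ℝ) : ℂ) • T (E 0).ind‖ ≤ θ ^ n * √Real.pi := by
      rw [norm_smul, Complex.norm_real, Real.norm_eq_abs, abs_of_nonneg (pow_nonneg h0 n)]
      gcongr
      refine (norm_multiplierCLM_le hm hm1 _).trans_eq ?_
      rw [one_mul, DiscSet.norm_ind, hE.zero, volume_real_ball]
    calc ‖X‖ = ‖(X - ((θ ^ n : ℝ) : ℂ) • T (E 0).ind) + ((θ ^ n : ℝ) : ℂ) • T (E 0).ind‖ := by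
          rw [sub_add_cancel]
      _ ≤ _ := (norm_add_le _ _).trans (by linarith)
  obtain ⟨hXi, hXn⟩ := setIntegral_ball_norm_le X
  obtain ⟨hTi, -⟩ := setIntegral_ball_norm_le (T (E n).ind)
  obtain ⟨hBi, hBv⟩ := integral_lamBound (E := E) θ n
  have hXint : Integrable (D.indicator fun z => ‖X z‖) :=
    (integrable_indicator_iff hD).2 hXi.norm
  have hTint : Integrable ((D \ (E n : Set ℂ)).indicator fun z => ‖T (E n).ind z‖) :=
    (integrable_indicator_iff hDE).2 (hTi.mono_set Set.sdiff_subset).norm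
  have hpt : ∀ᵐ z, B z - D.indicator (fun z => ‖X z‖) z ≤
      (D \ (E n : Set ℂ)).indicator (fun z => ‖T (E n).ind z‖) z := by
    filter_upwards [coeFn_lamLp θ E n, Lp.coeFn_sub (T (E n).ind) P] with z hP hXz
    by_cases hz : z ∈ D
    · have hpw := lamBound_le_abs_lamValue h0 h1
        (u := fun k => (E k : Set ℂ).indicator (fun _ => (1 : ℝ)) z)
        (by simp [hE.zero, show z ∈ Metric.ball (0 : ℂ) 1 from hz])
        (fun k => by by_cases h : z ∈ (E k : Set ℂ) <;> simp [h])
        (fun k => Set.indicator_le_indicator_of_subset (hE.subset k) (fun _ => zero_le_one) z) n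
      rw [Set.indicator_of_mem hz]
      by_cases hzn : z ∈ (E n : Set ℂ)
      · rcases hpw with ⟨-, h, -⟩ | ⟨h, -⟩
        · have hB0 : B z = 0 := h
          simp [hB0, hzn]
        · simp [hzn] at h
      · rcases hpw with ⟨h, -⟩ | ⟨-, h⟩
        · simp [hzn] at h
        · rw [Set.indicator_of_mem (show z ∈ D \ (E n : Set ℂ) from ⟨hz, hzn⟩), hXz, Pi.sub_apply]
          have hPn : B z ≤ ‖P z‖ := by
            rw [hP, Complex.norm_real, Real.norm_eq_abs]
            exact h
          have := norm_sub_norm_le (P z) (T (E n).ind z)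
          rw [norm_sub_rev] at this
          linarith
    · have hB0 : B z = 0 := by
        have hk : (fun k => (E k : Set ℂ).indicator (fun _ => (1 : ℝ)) z) = fun _ => 0 := by
          funext k
          exact Set.indicator_of_notMem (fun h => hz ((E k).2.2 h)) _
        have hz0 : ∀ j, lamBound θ (fun _ => 0) j = 0 := by
          intro j
          induction j with
          | zero => rfl
          | succ j ih => simp [lamBound, ih]
        simp only [B, hk, hz0]
      simp [hB0, hz]
  have hmono := integral_mono_ae (hBi.sub hXint) hTint hpt
  simp only [Pi.sub_apply] at hmono
  rw [integral_sub hBi hXint, hBv, integral_indicator hD, integral_indicator hDE] at hmono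
  have hpi : √Real.pi * √Real.pi = Real.pi := Real.mul_self_sqrt Real.pi_pos.le
  have hfin : √Real.pi * ‖X‖ ≤ θ ^ n * Real.pi + √Real.pi * (n * ε) := by
    calc √Real.pi * ‖X‖ ≤ √Real.pi * (θ ^ n * √Real.pi + n * ε) := by gcongr
      _ = θ ^ n * (√Real.pi * √Real.pi) + √Real.pi * (n * ε) := by ring
      _ = _ := by rw [hpi]
  linarith

/-! ### Choice of parameters. -/

theorem tendsto_volume_lamination {m : ℂ → ℂ} {hm : MemLp m ∞ (volume : Measure ℂ)} {θ : ℝ}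
    {ε : ℕ → ℝ} (hε : Tendsto ε atTop (𝓝 0)) {E : ℕ → ℕ → DiscSet}
    (hE : ∀ i, IsLamination m hm θ (ε i) (E i)) (k : ℕ) :
    Tendsto (fun i => volume.real (E i k : Set ℂ)) atTop (𝓝 (θ ^ k * Real.pi)) := by
  induction k with
  | zero => simp [(hE _).zero, volume_real_ball]
  | succ k ih =>
    have h1 := squeeze_zero_norm (f := fun i => volume.real (E i (k + 1) : Set ℂ) -
      θ * volume.real (E i k : Set ℂ)) (fun i => (hE i).measure k) hε
    have h2 := h1.add (ih.const_mul θ)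
    simp only [sub_add_cancel] at h2
    convert h2 using 2
    ring

/-- Any θ in (0, 1) with `η < θ ^ 2` works, since `θ * (-log θ) ≤ 1 - θ`. -/
theorem exists_ratio {η : ℝ} (hη : η < 1) :
    ∃ θ : ℝ, 0 < θ ∧ θ < 1 ∧ η * -Real.log θ < θ * (1 - θ) := by
  obtain ⟨θ, hθ0, hθ1, hθ⟩ : ∃ θ : ℝ, 0 < θ ∧ θ < 1 ∧ η < θ ^ 2 := by
    rcases le_or_gt η 0 with h | h
    · exact ⟨1 / 2, by norm_num, by norm_num, by norm_num; linarith⟩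
    · exact ⟨(1 + η) / 2, by linarith, by linarith, by nlinarith⟩
  refine ⟨θ, hθ0, hθ1, ?_⟩
  have hlog : 0 < -Real.log θ := neg_pos.2 (Real.log_neg hθ0 hθ1)
  have hlog' : θ * -Real.log θ ≤ 1 - θ := by
    have h := Real.one_sub_inv_le_log_of_pos hθ0
    have h2 : θ * (1 - θ⁻¹) = θ - 1 := by rw [mul_sub, mul_inv_cancel₀ hθ0.ne', mul_one]
    nlinarith
  calc η * -Real.log θ < θ ^ 2 * -Real.log θ := by gcongr
    _ = θ * (θ * -Real.log θ) := by ring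
    _ ≤ θ * (1 - θ) := by gcongr

/-- Sharpness of the logarithmic bound for multipliers whose symbol is bounded by `1` and has both
limits `1` and `-1` in some directions. -/
theorem exists_le_setIntegral_multiplier {m : ℂ → ℂ} (hm : MemLp m ∞ (volume : Measure ℂ))
    (hmm : Measurable m) (hm1 : ∀ ξ, ‖m ξ‖ ≤ 1)
    (hs : ∀ k : ℕ, ∃ e, HasDirectionalLimit m e ((-1) ^ k)) {η : ℝ} (hη : η < 1) :
    ∃ (E D : Set ℂ) (hE : MeasurableSet E) (hE' : volume E ≠ ∞),
      MeasurableSet D ∧ E ⊆ D ∧ D ⊆ Metric.ball (0 : ℂ) 1 ∧ 0 < volume.real E ∧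
      η * (volume.real E *
          Real.log (Real.exp 1 * volume.real D / (2 * volume.real E))) ≤
        ∫ z in D \ E, ‖fourierMultiplier m hm (indicatorConstLp 2 hE hE' (1 : ℂ)) z‖ := by
  obtain ⟨θ, h0, h1, hgap⟩ := exists_ratio hη
  -- The gain per layer, relative to `|E n|`, must absorb two bounded terms: 1 from the image of the
  -- disc, and `η (1 - log 2)` from the constant `e / 2` in the logarithm.
  obtain ⟨n, hn⟩ := exists_nat_gt
    ((1 + η * (1 - Real.log 2)) / (θ * (1 - θ) - η * -Real.log θ))
  rw [div_lt_iff₀ (by linarith)] at hn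
  -- With θ and `n` fixed, the tolerance `1 / (i + 1)` tends to 0. The inequality is strict in the
  -- limit, hence holds for some `i`.
  choose E hE using fun i : ℕ => exists_isLamination hm hmm hm1 hs h0.le h1.le
    (Nat.one_div_pos_of_nat (α := ℝ) (n := i))
  have hμ := tendsto_volume_lamination tendsto_one_div_add_atTop_nhds_zero_nat hE
  have hpos : 0 < θ ^ n * Real.pi := by positivity
  have hleft : Tendsto (fun i => η * (volume.real (E i n : Set ℂ) *
      Real.log (Real.exp 1 * Real.pi / (2 * volume.real (E i n : Set ℂ))))) atTop
      (𝓝 (η * (θ ^ n * Real.pi *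
        Real.log (Real.exp 1 * Real.pi / (2 * (θ ^ n * Real.pi)))))) := by
    refine ((hμ n).mul (Tendsto.log ?_ (by positivity))).const_mul η
    exact tendsto_const_nhds.div ((hμ n).const_mul 2) (by positivity)
  have hright : Tendsto (fun i => lamBound θ (fun k => volume.real (E i k : Set ℂ)) n -
      θ ^ n * Real.pi - √Real.pi * (n * (1 / ((i : ℝ) + 1)))) atTop
      (𝓝 (n * θ ^ (n + 1) * (1 - θ) * Real.pi - θ ^ n * Real.pi - √Real.pi * (n * 0))) := by
    rw [← lamBound_const_mul_pow]
    exact ((tendsto_lamBound hμ n).sub_const _).sub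
      ((tendsto_one_div_add_atTop_nhds_zero_nat.const_mul _).const_mul _)
  have hlog : Real.log (Real.exp 1 * Real.pi / (2 * (θ ^ n * Real.pi))) =
      1 - Real.log 2 + n * -Real.log θ := by
    rw [Real.log_div (by positivity) (by positivity), Real.log_mul (by positivity) (by positivity),
      Real.log_mul (by positivity) (by positivity), Real.log_mul (by positivity) (by positivity),
      Real.log_pow, Real.log_exp]
    ring
  have hlt : η * (θ ^ n * Real.pi * Real.log (Real.exp 1 * Real.pi / (2 * (θ ^ n * Real.pi)))) <
      n * θ ^ (n + 1) * (1 - θ) * Real.pi - θ ^ n * Real.pi - √Real.pi * (n * 0) := by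
    rw [hlog]
    have h2 := mul_lt_mul_of_pos_left hn hpos
    rw [pow_succ]
    nlinarith
  obtain ⟨i, hi1, hi2⟩ := ((hleft.eventually_lt hright hlt).and
    ((tendsto_order.1 (hμ n)).1 0 hpos)).exists
  refine ⟨E i n, Metric.ball 0 1, (E i n).2.1, measure_ne_top_of_subset_ball (E i n).2.2,
    Metric.isOpen_ball.measurableSet, (E i n).2.2, subset_rfl, hi2, ?_⟩
  rw [volume_real_ball, ← multiplierCLM_eq_fourierMultiplier]
  exact hi1.le.trans ((hE i).le_setIntegral hm1 h0.le h1.le n)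

/-! ### Directional limits of the Beurling symbol. -/

/-- The symbol is invariant under nonzero real dilations, negative ones included, so `ξ + t e` may
be replaced by `ξ / t + e`; continuity at `e` then gives the limit. -/
theorem tendsto_beurlingSymbol {e : ℂ} (he : e ≠ 0) {l : ℤ} (hl : l ≠ 0) (ξ : ℂ) :
    Tendsto (fun N : ℕ => beurlingSymbol (ξ + ((N : ℝ) * l : ℝ) • e)) atTop
      (𝓝 (beurlingSymbol e)) := by
  have hcont : ContinuousAt beurlingSymbol e :=
    Complex.continuous_conj.continuousAt.div continuousAt_id he
  have hlim : Tendsto (fun N : ℕ => ((N : ℝ) * l : ℝ)⁻¹ • ξ + e) atTop (𝓝 e) := by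
    have h1 : Tendsto (fun N : ℕ => ((N : ℝ) * l : ℝ)⁻¹) atTop (𝓝 0) := by
      simp_rw [mul_inv]
      simpa using (tendsto_inv_atTop_nhds_zero_nat (𝕜 := ℝ)).mul_const ((l : ℝ)⁻¹)
    simpa using (h1.smul_const ξ).add_const e
  refine (hcont.tendsto.comp hlim).congr' ?_
  filter_upwards [eventually_gt_atTop 0] with N hN
  have ht : ((N : ℝ) * l : ℝ) ≠ 0 := by positivity
  set t : ℝ := (N : ℝ) * l
  have htC : (t : ℂ) ≠ 0 := Complex.ofReal_ne_zero.2 ht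
  have h2 : ξ + t • e = t * (t⁻¹ • ξ + e) := by
    rw [Complex.real_smul, Complex.real_smul, Complex.ofReal_inv, mul_add, mul_inv_cancel_left₀ htC]
  rw [Function.comp_apply, h2, beurlingSymbol, beurlingSymbol, map_mul, Complex.conj_ofReal,
    mul_div_mul_left _ _ htC]

theorem exists_hasDirectionalLimit_re (k : ℕ) :
    ∃ e, HasDirectionalLimit (fun ξ : ℂ => ((beurlingSymbol ξ).re : ℂ)) e ((-1) ^ k) := by
  have key : ∀ e : ℂ, ‖e‖ = 1 → HasDirectionalLimit (fun ξ : ℂ => ((beurlingSymbol ξ).re : ℂ)) e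
      ((beurlingSymbol e).re : ℂ) := fun e he => ⟨he, fun l hl ξ =>
    ((Complex.continuous_ofReal.comp Complex.continuous_re).tendsto _).comp
      (tendsto_beurlingSymbol (norm_ne_zero_iff.1 (by rw [he]; exact one_ne_zero)) hl ξ)⟩
  rcases Nat.even_or_odd k with hk | hk
  · refine ⟨1, ?_⟩
    simpa [hk.neg_one_pow, beurlingSymbol] using key 1 (by simp)
  · refine ⟨Complex.I, ?_⟩
    simpa [hk.neg_one_pow, beurlingSymbol] using key Complex.I (by simp)

theorem exists_hasDirectionalLimit_im (k : ℕ) :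
    ∃ e, HasDirectionalLimit (fun ξ : ℂ => ((beurlingSymbol ξ).im : ℂ)) e ((-1) ^ k) := by
  have key : ∀ e : ℂ, ‖e‖ = 1 → HasDirectionalLimit (fun ξ : ℂ => ((beurlingSymbol ξ).im : ℂ)) e
      ((beurlingSymbol e).im : ℂ) := fun e he => ⟨he, fun l hl ξ =>
    ((Complex.continuous_ofReal.comp Complex.continuous_im).tendsto _).comp
      (tendsto_beurlingSymbol (norm_ne_zero_iff.1 (by rw [he]; exact one_ne_zero)) hl ξ)⟩
  have hsymb : ∀ e : ℂ, ‖e‖ = 1 → (beurlingSymbol e).im = -(2 * e.re * e.im) := by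
    intro e he
    have h1 : Complex.normSq e = 1 := by rw [Complex.normSq_eq_norm_sq, he, one_pow]
    rw [beurlingSymbol, Complex.div_im, h1]
    simp
    ring
  have hsq : √2 / 2 * (√2 / 2) = (1 / 2 : ℝ) := by
    rw [div_mul_div_comm, Real.mul_self_sqrt (by norm_num)]
    norm_num
  have hnorm : ∀ b : ℝ, b * b = 1 / 2 → ‖(⟨√2 / 2, b⟩ : ℂ)‖ = 1 := by
    intro b hb
    rw [Complex.norm_def, Complex.normSq_mk, hsq, hb]
    norm_num
  -- The symbol equals `i` at the unit vector of argument -π/4 and `-i` at that of argument π/4.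
  rcases Nat.even_or_odd k with hk | hk
  · have hn := hnorm (-(√2 / 2)) (by rw [neg_mul_neg, hsq])
    refine ⟨⟨√2 / 2, -(√2 / 2)⟩, ?_⟩
    have h := key _ hn
    rw [hsymb _ hn, show -(2 * (√2 / 2) * -(√2 / 2)) = (1 : ℝ) by linear_combination 2 * hsq] at h
    simpa [hk.neg_one_pow] using h
  · have hn := hnorm (√2 / 2) hsq
    refine ⟨⟨√2 / 2, √2 / 2⟩, ?_⟩
    have h := key _ hn
    rw [hsymb _ hn, show -(2 * (√2 / 2) * (√2 / 2)) = (-1 : ℝ) by linear_combination -2 * hsq] at h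
    simpa [hk.neg_one_pow] using h

end

/-- Sharpness of the logarithmic bound for the real and imaginary parts of the Beurling–Ahlfors
operator. `indicatorConstLp 2 hE hE' 1` is the indicator function of `E` as an element of `L²`. -/
theorem theorem1p3 :
    (∀ η : ℝ, η < 1 →
      ∃ (E D : Set ℂ) (hE : MeasurableSet E) (hE' : volume E ≠ ∞),
        MeasurableSet D ∧ E ⊆ D ∧ D ⊆ Metric.ball (0 : ℂ) 1 ∧ 0 < volume.real E ∧
        η * (volume.real E *
            Real.log (Real.exp 1 * volume.real D / (2 * volume.real E))) ≤
          ∫ z in D \ E, ‖reBeurling (indicatorConstLp 2 hE hE' (1 : ℂ)) z‖) ∧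
    (∀ η : ℝ, η < 1 →
      ∃ (E D : Set ℂ) (hE : MeasurableSet E) (hE' : volume E ≠ ∞),
        MeasurableSet D ∧ E ⊆ D ∧ D ⊆ Metric.ball (0 : ℂ) 1 ∧ 0 < volume.real E ∧
        η * (volume.real E *
            Real.log (Real.exp 1 * volume.real D / (2 * volume.real E))) ≤
          ∫ z in D \ E, ‖imBeurling (indicatorConstLp 2 hE hE' (1 : ℂ)) z‖) := by
  refine ⟨fun η hη => ?_, fun η hη => ?_⟩
  · exact exists_le_setIntegral_multiplier memLp_re_beurlingSymbol
      (Complex.measurable_ofReal.comp (Complex.measurable_re.comp measurable_beurlingSymbol))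
      (fun ξ => by simpa using (Complex.abs_re_le_norm _).trans (norm_beurlingSymbol_le ξ))
      exists_hasDirectionalLimit_re hη
  · exact exists_le_setIntegral_multiplier memLp_im_beurlingSymbol
      (Complex.measurable_ofReal.comp (Complex.measurable_im.comp measurable_beurlingSymbol))
      (fun ξ => by simpa using (Complex.abs_im_le_norm _).trans (norm_beurlingSymbol_le ξ))
      exists_hasDirectionalLimit_im hη
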